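/- Let $\mathcal A$ be a finite alphabet and let $Z_1, Z_2, \ldots$ be independent random variables, each uniformly distributed on $\mathcal A$. Let $H = -\sum_{a\in\mathcal A} \mathbb P(Z_1=a)\log_2 \mathbb P(Z_1=a)$ be the entropy of the process in bits. For a block length $\ell\ge 1$ put $X_i = (Z_{(i-1)\ell+1},\ldots,Z_{i\ell})\in\mathcal A^\ell$ for $i \ge 1$, and let $$S_i = S_i^{(\ell)} = \min\{t\ge 1 : X_{i+t}=X_i\}$$ be the non-overlapping return time of the $i$-th block. Suppose that, as $\ell\to\infty$, the number of blocks $k(\ell)\in\mathbb N$ tends to infinity in such a way that $k(\ell)\,\ell\,|\mathcal A|^{-\ell}\to 0$. Then, as $\ell \to \infty$, $$\frac{\sum_{i=1}^{k(\ell)}\left(\log S_i-\ell H\log 2+\gamma\right)}{\sqrt{k(\ell)\,\pi^2/6}}\ \stackrel{d}{\longrightarrow}\ N(0,1),$$ where $\log$ is the natural logarithm, $\gamma$ is Euler's constant, and $\stackrel{d}{\longrightarrow}$ denotes convergence in distribution. -/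

import Mathlib

open Filter Topology MeasureTheory ProbabilityTheory

noncomputable section

namespace ReturnTimeCLT

variable {Ω A : Type*}

/-- The `j`-th block of length `ℓ` of the process `Z`. Times and blocks are numbered from `0`, so
block `j` is `(Z (j * ℓ), …, Z (j * ℓ + ℓ - 1))`; with numbering from `1` this is
`X_{j+1} = (Z_{jℓ+1}, …, Z_{(j+1)ℓ})`. -/
def block (Z : ℕ → Ω → A) (ℓ j : ℕ) (ω : Ω) : Fin ℓ → A :=
  fun r => Z (j * ℓ + (r : ℕ)) ω

/-- The non-overlapping return time of the `j`-th block of length `ℓ`: the least `t ≥ 1` such that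
block `j + t` equals block `j`. (If the block never reappears, which is a null event for an
independent equidistributed process, the value is the conventional `sInf ∅ = 0`.) -/
def returnTime (Z : ℕ → Ω → A) (ℓ j : ℕ) (ω : Ω) : ℕ :=
  sInf {t : ℕ | 1 ≤ t ∧ block Z ℓ (j + t) ω = block Z ℓ j ω}

/-- The Shannon entropy, in bits, of a random variable `X` with values in a finite alphabet:
`- ∑ a, P(X = a) log₂ P(X = a)`. -/
def entropyBits [Fintype A] [MeasurableSpace Ω] (P : Measure Ω) (X : Ω → A) : ℝ :=
  - ∑ a : A, P.real (X ⁻¹' {a}) * Real.logb 2 (P.real (X ⁻¹' {a}))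

end ReturnTimeCLT

end

set_option linter.unusedSectionVars false

namespace ReturnTimeCLT

/-! The blocks are independent and uniform on a set of `m = |A|^ℓ` symbols, and `log m = ℓ H log 2`.
The return time of block `j` is the waiting time for the symbol `X j` in the later entries. Since `X
j` is independent of that future, the conditional mean of `f (return time)` given the future is the
average of `f (hit X j a)` over all symbols `a` (`hitMean`,
`IsUniformSequence.integral_return_mul`).

This random average is nearly constant. The fraction of symbols not seen within `u` steps has mean
`(1 - 1/m)^u` and small variance, and summation by parts over `u` puts `hitMean` within `O(|s|/√m)`
in L¹ of the geometric mean of `f`, when `f` has increments of size `|s|/u`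
(`IsUniformSequence.integral_norm_hitMean_sub_le`). Replacing the factors by constants one at a
time, from the earliest block on, shows that the characteristic function of a sum over `k` blocks is
a `k`-th power up to `k · O(|s|/√m)`, although the return times are dependent.

A geometric variable divided by `m` is close to an exponential variable `E`, so the base of the
power may be taken to be the characteristic function `e^{iγs} Γ(1+is)` of `log E + γ`
(`norm_geomMean_logPhase_sub_le`). That variable has mean `0` and variance `π²/6`, so the power
tends to the Gaussian characteristic function (`tendsto_logExpChar_pow`). With `s` of order `1/√k`
the total error is of order `√(k/m)`, which tends to `0`. -/

/-! ### Independent uniform sequences and avoidance probabilities. -/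

/-- The σ-algebra generated by the entries of `X` with index larger than `j`. -/
@[reducible]
def future {Ω B : Type*} [MeasurableSpace B] (X : ℕ → Ω → B) (j : ℕ) : MeasurableSpace Ω :=
  ⨆ i ∈ Set.Ioi j, MeasurableSpace.comap (X i) inferInstance

/-- A sequence of independent random variables, each uniformly distributed on the finite type `B`,
with independence recorded as independence of each entry from the later ones. -/
structure IsUniformSequence {Ω B : Type*} [MeasurableSpace Ω] [Fintype B] [MeasurableSpace B]
    (X : ℕ → Ω → B) (P : Measure Ω) : Prop where
  measurable : ∀ j, Measurable (X j)
  uniform : ∀ j a, P.real (X j ⁻¹' {a}) = 1 / (Fintype.card B : ℝ)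
  indep : ∀ j, Indep (MeasurableSpace.comap (X j) inferInstance) (future X j) P

/-- The first time `t ≥ 1` at which the sequence `X`, started at index `j`, takes the value `a`. -/
noncomputable def hit {Ω B : Type*} (X : ℕ → Ω → B) (j : ℕ) (a : B) (ω : Ω) : ℕ :=
  sInf {t : ℕ | 1 ≤ t ∧ X (j + t) ω = a}

/-- The event that none of the `u` entries of `X` after index `j` lies in `T`. -/
def avoid {Ω B : Type*} (X : ℕ → Ω → B) (j : ℕ) (T : Finset B) (u : ℕ) : Set Ω :=
  {ω | ∀ t < u, X (j + 1 + t) ω ∉ T}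

/-- Because `sInf ∅ = 0`, the infimum is at most `n` also when no `t` qualifies; hence the second
set in the union below. -/
theorem measurable_sInf_nat {Ω : Type*} [MeasurableSpace Ω] {p : ℕ → Ω → Prop}
    (hp : ∀ t, MeasurableSet {ω | p t ω}) : Measurable fun ω => sInf {t : ℕ | p t ω} := by
  refine measurable_of_Iic fun n => ?_
  have : (fun ω => sInf {t : ℕ | p t ω}) ⁻¹' Set.Iic n
      = (⋃ t ∈ Set.Iic n, {ω | p t ω}) ∪ ⋂ t, {ω | p t ω}ᶜ := by
    ext ω
    simp only [Set.mem_preimage, Set.mem_Iic, Set.mem_union, Set.mem_iUnion, Set.mem_iInter,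
      Set.mem_compl_iff, Set.mem_ofPred_eq, exists_prop]
    constructor
    · intro h
      by_cases hne : ∃ t, p t ω
      · exact Or.inl ⟨_, h, Nat.sInf_mem (s := {t | p t ω}) hne⟩
      · exact Or.inr (not_exists.mp hne)
    · rintro (⟨t, ht, h⟩ | h)
      · exact (Nat.sInf_le (s := {t | p t ω}) h).trans ht
      · have : {t | p t ω} = ∅ := Set.eq_empty_of_forall_notMem h
        simp [this]
  rw [this]
  exact (MeasurableSet.biUnion (Set.to_countable _) fun t _ => hp t).union
    (MeasurableSet.iInter fun t => (hp t).compl)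

section Uniform

variable {Ω B : Type*} [MeasurableSpace Ω] {P : Measure Ω} [IsProbabilityMeasure P]
  [Fintype B] [MeasurableSpace B] [MeasurableSingletonClass B] {X : ℕ → Ω → B}

theorem measurable_future {i j : ℕ} (h : j < i) : Measurable[future X j] (X i) := by
  refine Measurable.mono (comap_measurable (X i)) ?_ le_rfl
  exact le_iSup₂_of_le i h le_rfl

theorem IsUniformSequence.future_le (hX : IsUniformSequence X P) (j : ℕ) :
    future X j ≤ ‹MeasurableSpace Ω› :=
  iSup₂_le fun i _ => (hX.measurable i).comap_le

theorem measurable_hit_future (j : ℕ) (a : B) : Measurable[future X j] (hit X j a) := by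
  let := future X j
  refine measurable_sInf_nat fun t => ?_
  by_cases ht : 1 ≤ t
  · simp only [ht, true_and]
    exact measurable_future (X := X) (show j < j + t by omega) (measurableSet_singleton a)
  · simp [ht]

theorem measurableSet_avoid (j : ℕ) (T : Finset B) (u : ℕ) :
    MeasurableSet[future X j] (avoid X j T u) := by
  let := future X j
  have : avoid X j T u = ⋂ t ∈ Set.Iio u, (X (j + 1 + t) ⁻¹' (T : Set B))ᶜ := by
    ext; simp [avoid]
  rw [this]
  exact MeasurableSet.biInter (Set.to_countable _) fun t _ =>
    (measurable_future (X := X) (show j < j + 1 + t by omega) T.measurableSet).compl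

theorem IsUniformSequence.measureReal_preimage (hX : IsUniformSequence X P) (j : ℕ)
    (T : Finset B) : P.real (X j ⁻¹' (T : Set B)) = T.card / (Fintype.card B : ℝ) := by
  rw [← sum_measureReal_preimage_singleton T fun a _ => hX.measurable j (measurableSet_singleton a)]
  simp [hX.uniform, div_eq_mul_inv]

/-- The first entry is independent of the later ones, so each step contributes one factor. -/
theorem IsUniformSequence.measureReal_avoid (hX : IsUniformSequence X P) (j : ℕ)
    (T : Finset B) (u : ℕ) :
    P.real (avoid X j T u) = (1 - T.card / (Fintype.card B : ℝ)) ^ u := by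
  induction u generalizing j with
  | zero => simp [avoid]
  | succ u ih =>
    have h : avoid X j T (u + 1) = (X (j + 1) ⁻¹' (T : Set B))ᶜ ∩ avoid X (j + 1) T u := by
      ext ω
      simp only [avoid, Set.mem_ofPred_eq, Set.mem_inter_iff, Set.mem_compl_iff, Set.mem_preimage,
        Finset.mem_coe]
      constructor
      · refine fun h => ⟨by simpa using h 0 (by omega), fun t ht => ?_⟩
        have := h (t + 1) (by omega)
        rwa [show j + 1 + (t + 1) = j + 1 + 1 + t by ring] at this
      · rintro ⟨h0, h⟩ t ht
        rcases t with _ | t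
        · simpa using h0
        · rw [show j + 1 + (t + 1) = j + 1 + 1 + t by ring]
          exact h t (by omega)
    have hi := Indep_iff _ _ P |>.1 (hX.indep (j + 1)) (X (j + 1) ⁻¹' (T : Set B))ᶜ
      (avoid X (j + 1) T u) (MeasurableSet.compl ⟨_, T.measurableSet, rfl⟩)
      (measurableSet_avoid _ _ _)
    rw [h, measureReal_def, hi, ENNReal.toReal_mul, ← measureReal_def, ← measureReal_def, ih, probReal_compl_eq_one_sub (hX.measurable _ T.measurableSet),
      hX.measureReal_preimage, pow_succ, mul_comm]

end Uniform

/-! ### Hitting times and their tail events. -/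

section Hit

variable {Ω B : Type*} {X : ℕ → Ω → B}

theorem hit_spec {j : ℕ} {a : B} {ω : Ω} (h : ∃ t, 1 ≤ t ∧ X (j + t) ω = a) :
    1 ≤ hit X j a ω ∧ X (j + hit X j a ω) ω = a :=
  Nat.sInf_mem (s := {t : ℕ | 1 ≤ t ∧ X (j + t) ω = a}) h

theorem mem_avoid_singleton_iff {j : ℕ} {a : B} {ω : Ω} (h : ∃ t, 1 ≤ t ∧ X (j + t) ω = a)
    (u : ℕ) : ω ∈ avoid X j {a} u ↔ u < hit X j a ω := by
  obtain ⟨h1, h2⟩ := hit_spec h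
  simp only [avoid, Set.mem_ofPred_eq, Finset.mem_singleton]
  constructor
  · intro H
    by_contra! hle
    refine H (hit X j a ω - 1) (by omega) ?_
    rwa [show j + 1 + (hit X j a ω - 1) = j + hit X j a ω by omega]
  · intro H t ht heq
    have : hit X j a ω ≤ 1 + t :=
      Nat.sInf_le (s := {t : ℕ | 1 ≤ t ∧ X (j + t) ω = a})
        ⟨by omega, by rwa [show j + (1 + t) = j + 1 + t by ring]⟩
    omega

/-- A function of the hitting time is the sum of its increments over the times before it. -/
theorem hasSum_increments_hit (f : ℕ → ℂ) {j : ℕ} {a : B} {ω : Ω}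
    (h : ∃ t, 1 ≤ t ∧ X (j + t) ω = a) :
    HasSum (fun u => (f (u + 2) - f (u + 1)) * (avoid X j {a} (u + 1)).indicator 1 ω)
      (f (hit X j a ω) - f 1) := by
  obtain ⟨h1, -⟩ := hit_spec h
  obtain ⟨n, hn⟩ : ∃ n, hit X j a ω = n + 1 := ⟨hit X j a ω - 1, by omega⟩
  have hval : f (hit X j a ω) - f 1 = ∑ u ∈ Finset.range n,
      (f (u + 2) - f (u + 1)) * (avoid X j {a} (u + 1)).indicator (1 : Ω → ℂ) ω := by
    rw [hn, ← Finset.sum_range_sub (fun u => f (u + 1))]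
    refine Finset.sum_congr rfl fun u hu => ?_
    have : ω ∈ avoid X j {a} (u + 1) := by
      rw [mem_avoid_singleton_iff h, hn]
      have := Finset.mem_range.1 hu
      omega
    simp [this]
  rw [hval]
  refine hasSum_sum_of_ne_finset_zero fun u hu => ?_
  have : ω ∉ avoid X j {a} (u + 1) := by
    rw [mem_avoid_singleton_iff h, hn]
    have := Finset.mem_range.not.1 hu
    omega
  simp [this]

end Hit

/-! ### Concentration of the fraction of unseen symbols. -/

section Uniform

variable {Ω B : Type*} [MeasurableSpace Ω] {P : Measure Ω} [IsProbabilityMeasure P]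
  [Fintype B] [MeasurableSpace B] [MeasurableSingletonClass B] {X : ℕ → Ω → B}

theorem IsUniformSequence.ae_exists_hit (hX : IsUniformSequence X P) (hB : 0 < Fintype.card B)
    (j : ℕ) : ∀ᵐ ω ∂P, ∀ a, ∃ t, 1 ≤ t ∧ X (j + t) ω = a := by
  rw [ae_all_iff]
  intro a
  have hm : (1 : ℝ) ≤ Fintype.card B := by exact_mod_cast hB
  have key : P.real {ω | ¬ ∃ t, 1 ≤ t ∧ X (j + t) ω = a} ≤ 0 := by
    refine ge_of_tendsto' (tendsto_pow_atTop_nhds_zero_of_lt_one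
      (r := 1 - 1 / (Fintype.card B : ℝ)) ?_ ?_) fun u => ?_
    · rw [sub_nonneg, div_le_one (by linarith)]; exact hm
    · have : 0 < 1 / (Fintype.card B : ℝ) := by positivity
      linarith
    · have := hX.measureReal_avoid j {a} u
      rw [Finset.card_singleton, Nat.cast_one] at this
      rw [← this]
      refine measureReal_mono fun ω hω t _ hmem => hω ⟨1 + t, by omega, ?_⟩
      rw [← add_assoc]
      simpa using hmem
  rw [ae_iff]
  exact (measureReal_eq_zero_iff).1 (le_antisymm key measureReal_nonneg)

theorem measurableSet_avoid' (hX : IsUniformSequence X P) (j : ℕ) (T : Finset B) (u : ℕ) :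
    MeasurableSet (avoid X j T u) :=
  hX.future_le j _ (measurableSet_avoid j T u)

/-- The fraction of the symbols that are not among the `u` entries of `X` after index `j`. -/
noncomputable def unseen (X : ℕ → Ω → B) (j u : ℕ) (ω : Ω) : ℝ :=
  (∑ a, (avoid X j {a} u).indicator 1 ω) / Fintype.card B

theorem IsUniformSequence.integral_unseen (hX : IsUniformSequence X P)
    (hB : 0 < Fintype.card B) (j u : ℕ) :
    ∫ ω, unseen X j u ω ∂P = (1 - 1 / (Fintype.card B : ℝ)) ^ u := by
  have hm : (Fintype.card B : ℝ) ≠ 0 := by positivity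
  have hA := fun a => measurableSet_avoid' hX j {a} u
  have hI : ∀ a, Integrable ((avoid X j {a} u).indicator (1 : Ω → ℝ)) P := fun a =>
    (integrable_const (1 : ℝ)).indicator (hA a)
  simp only [unseen]
  rw [integral_div, integral_finsetSum _ fun a _ => hI a]
  simp_rw [fun a => integral_indicator_one (μ := P) (hA a), hX.measureReal_avoid]
  simp only [Finset.card_singleton, Nat.cast_one, Finset.sum_const, Finset.card_univ, nsmul_eq_mul]
  field_simp

theorem measurable_unseen (hX : IsUniformSequence X P) (j u : ℕ) :
    Measurable (unseen X j u) :=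
  (Finset.measurable_fun_sum _ fun a _ =>
    (measurable_const.indicator (measurableSet_avoid' hX j {a} u))).div_const _

theorem unseen_nonneg (j u : ℕ) (ω : Ω) : 0 ≤ unseen X j u ω :=
  div_nonneg (Finset.sum_nonneg fun _ _ => Set.indicator_nonneg (fun _ _ => zero_le_one) _)
    (Nat.cast_nonneg _)

theorem unseen_le_one (j u : ℕ) (ω : Ω) : unseen X j u ω ≤ 1 := by
  refine div_le_one_of_le₀ ?_ (Nat.cast_nonneg _)
  refine (Finset.sum_le_sum (g := fun _ => (1 : ℝ)) fun a _ =>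
    Set.indicator_le_self' (fun _ _ => zero_le_one) ω).trans ?_
  simp

/-- The square is a double sum over pairs of symbols. Distinct symbols are negatively correlated, as
`1 - 2/m ≤ (1 - 1/m)^2`, so only the diagonal adds to the squared mean. Bounding `1 - q^u` there by
`u/m` instead of `1` spares a factor `log m` in the later sum over `u`. -/
theorem IsUniformSequence.integral_unseen_sq_le (hX : IsUniformSequence X P)
    (hB : 2 ≤ Fintype.card B) (j u : ℕ) :
    ∫ ω, unseen X j u ω ^ 2 ∂P ≤ ((1 - 1 / (Fintype.card B : ℝ)) ^ u) ^ 2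
      + (1 - 1 / (Fintype.card B : ℝ)) ^ u * u / (Fintype.card B : ℝ) ^ 2 := by
  classical
  set m : ℝ := (Fintype.card B : ℝ) with hm
  have hm2 : (2 : ℝ) ≤ m := by rw [hm]; exact_mod_cast hB
  have hm0 : m ≠ 0 := by positivity
  set q : ℝ := 1 - 1 / m with hq
  have hq0 : 0 ≤ q := by
    rw [hq, sub_nonneg, div_le_one (by linarith)]; linarith
  have hq1 : q ≤ 1 := by
    have : 0 ≤ 1 / m := by positivity
    linarith
  have hsq : ∀ ω, unseen X j u ω ^ 2
      = (∑ a, ∑ b, (avoid X j {a, b} u).indicator (1 : Ω → ℝ) ω) / m ^ 2 := by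
    intro ω
    rw [unseen, div_pow, sq (∑ a, _), Finset.sum_mul_sum]
    congr 1
    refine Finset.sum_congr rfl fun a _ => Finset.sum_congr rfl fun b _ => ?_
    rw [← Pi.mul_apply, ← Set.inter_indicator_one]
    congr 1
    ext ω
    simp only [avoid, Set.mem_inter_iff, Set.mem_ofPred_eq, Finset.mem_singleton,
      Finset.mem_insert, not_or]
    grind
  have hA := fun a b : B => measurableSet_avoid' hX j {a, b} u
  have hI : ∀ a b, Integrable ((avoid X j {a, b} u).indicator (1 : Ω → ℝ)) P := fun a b =>
    (integrable_const (1 : ℝ)).indicator (hA a b)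
  have hint : ∫ ω, unseen X j u ω ^ 2 ∂P = (∑ a, ∑ b, P.real (avoid X j {a, b} u)) / m ^ 2 := by
    simp_rw [hsq]
    rw [integral_div, integral_finsetSum _ fun a _ => integrable_finsetSum _ fun b _ => hI a b]
    congr 1
    refine Finset.sum_congr rfl fun a _ => ?_
    rw [integral_finsetSum _ fun b _ => hI a b]
    exact Finset.sum_congr rfl fun b _ => integral_indicator_one (hA a b)
  have hbern : 1 - q ^ u ≤ u / m := by
    have := one_add_mul_le_pow (a := -(1 / m)) (by
      have : 1 / m ≤ 1 := by rw [div_le_one (by linarith)]; linarith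
      linarith) u
    rw [← sub_eq_add_neg, ← hq] at this
    have h2 : (u : ℝ) * -(1 / m) = - (u / m) := by ring
    linarith
  have hterm : ∀ a b : B, P.real (avoid X j {a, b} u)
      ≤ (q ^ u) ^ 2 + if a = b then q ^ u * (u / m) else 0 := by
    intro a b
    rw [hX.measureReal_avoid]
    by_cases hab : a = b
    · subst hab
      simp only [Finset.mem_singleton, Finset.insert_eq_of_mem, Finset.card_singleton,
        Nat.cast_one, if_true]
      rw [← hm, ← hq]
      nlinarith [pow_nonneg hq0 u]
    · rw [Finset.card_pair hab, if_neg hab, add_zero, ← pow_mul, mul_comm u 2, pow_mul]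
      refine pow_le_pow_left₀ ?_ ?_ u
      · rw [sub_nonneg, div_le_one (by linarith)]; exact_mod_cast hB
      · rw [← hm, hq]
        push_cast
        have : (1 - 1 / m) ^ 2 = 1 - 2 / m + (1 / m) ^ 2 := by ring
        rw [this]
        nlinarith [sq_nonneg (1 / m)]
  rw [hint, div_le_iff₀ (by positivity)]
  refine (Finset.sum_le_sum fun a _ => Finset.sum_le_sum fun b _ => hterm a b).trans ?_
  simp only [Finset.sum_add_distrib, Finset.sum_const, Finset.card_univ, nsmul_eq_mul,
    Finset.sum_ite_eq, Finset.mem_univ, if_true]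
  rw [← hm]
  apply le_of_eq
  field_simp

theorem IsUniformSequence.integral_abs_unseen_sub_le (hX : IsUniformSequence X P)
    (hB : 2 ≤ Fintype.card B) (j u : ℕ) :
    ∫ ω, |unseen X j u ω - (1 - 1 / (Fintype.card B : ℝ)) ^ u| ∂P
      ≤ √((1 - 1 / (Fintype.card B : ℝ)) ^ u * u) / Fintype.card B := by
  set m : ℝ := (Fintype.card B : ℝ) with hm
  have hm2 : (2 : ℝ) ≤ m := by rw [hm]; exact_mod_cast hB
  set q : ℝ := 1 - 1 / m with hq
  have hmeas := measurable_unseen hX j u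
  have hL : MemLp (unseen X j u) 2 P :=
    MemLp.of_bound hmeas.aestronglyMeasurable 1 (ae_of_all _ fun ω => by
      rw [Real.norm_of_nonneg (unseen_nonneg j u ω)]; exact unseen_le_one j u ω)
  have hY : MemLp (fun ω => |unseen X j u ω - q ^ u|) 2 P :=
    (hL.sub (memLp_const (q ^ u))).norm
  -- Nonnegativity of this variance is the Cauchy–Schwarz bound of the L¹ norm by the L² norm.
  have h1 := variance_nonneg (fun ω => |unseen X j u ω - q ^ u|) P
  rw [variance_eq_sub hY] at h1
  have h2 : P[(fun ω => |unseen X j u ω - q ^ u|) ^ 2]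
      = ∫ ω, unseen X j u ω ^ 2 ∂P - (q ^ u) ^ 2 := by
    have : ∀ ω, ((fun ω => |unseen X j u ω - q ^ u|) ^ 2) ω
        = unseen X j u ω ^ 2 - (2 * q ^ u) * unseen X j u ω + (q ^ u) ^ 2 := fun ω => by
      simp only [Pi.pow_apply, sq_abs]; ring
    have hi := hL.integrable (by norm_num)
    have hi2 := hL.integrable_sq
    have hi3 : Integrable (fun ω => unseen X j u ω ^ 2 - (2 * q ^ u) * unseen X j u ω) P :=
      hi2.sub (hi.const_mul _)
    simp_rw [this]
    rw [integral_add hi3 (integrable_const _),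
      integral_sub hi2 (hi.const_mul _), integral_const_mul, hX.integral_unseen (by omega)]
    simp only [integral_const, probReal_univ, smul_eq_mul]
    ring
  have h3 := hX.integral_unseen_sq_le hB j u
  rw [← hm, ← hq] at h3
  rw [le_div_iff₀ (by linarith)]
  apply Real.le_sqrt_of_sq_le
  rw [mul_pow, ← le_div_iff₀ (by positivity)]
  rw [h2] at h1
  linarith

end Uniform

/-! ### Two deterministic sums. -/

theorem sum_inv_sqrt_le (n : ℕ) : ∑ u ∈ Finset.range n, 1 / √((u : ℝ) + 1) ≤ 2 * √n := by
  induction n with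
  | zero => simp
  | succ n ih =>
    rw [Finset.sum_range_succ]
    have h1 : 0 ≤ √(n : ℝ) := Real.sqrt_nonneg _
    have h2 : 0 < √((n : ℝ) + 1) := Real.sqrt_pos.2 (by positivity)
    have h3 : √(n : ℝ) ^ 2 = n := Real.sq_sqrt (by positivity)
    have h4 : √((n : ℝ) + 1) ^ 2 = n + 1 := Real.sq_sqrt (by positivity)
    have h5 : 1 / √((n : ℝ) + 1) ≤ 2 * √((n : ℝ) + 1) - 2 * √n := by
      rw [div_le_iff₀ h2]
      nlinarith [sq_nonneg (√((n : ℝ) + 1) - √n)]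
    push_cast
    linarith

/-- For `u < m` the power is at most `1` and the sum of `1/√(u+1)` is at most `2√m`; for `u ≥ m` the
denominator is at least `√m` and the geometric series in `√q` is at most `2m`. -/
theorem sum_sqrt_pow_div_sqrt_le {m : ℕ} (hm : 0 < m) (n : ℕ) :
    ∑ u ∈ Finset.range n, √((1 - 1 / (m : ℝ)) ^ (u + 1)) / √((u : ℝ) + 1) ≤ 4 * √m := by
  have hm1 : (1 : ℝ) ≤ m := by exact_mod_cast hm
  set q : ℝ := 1 - 1 / (m : ℝ) with hq
  have hq0 : 0 ≤ q := by
    rw [hq, sub_nonneg, div_le_one (by linarith)]; exact hm1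
  have hq1 : q < 1 := by
    have : 0 < 1 / (m : ℝ) := by positivity
    linarith
  have hr0 : 0 ≤ √q := Real.sqrt_nonneg _
  have hr1 : √q < 1 := by rw [Real.sqrt_lt' one_pos]; simpa using hq1
  have hrr : √q ^ 2 = q := Real.sq_sqrt hq0
  have hsm : 0 < √(m : ℝ) := Real.sqrt_pos.2 (by linarith)
  have hpow : ∀ u : ℕ, √(q ^ u) = √q ^ u := fun u => by
    rw [Real.sqrt_eq_iff_mul_self_eq (by positivity) (by positivity), ← mul_pow,
      Real.mul_self_sqrt hq0]
  have hterm : ∀ u ∈ Finset.range n, √(q ^ (u + 1)) / √((u : ℝ) + 1)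
      ≤ (if u ∈ Finset.range m then 1 / √((u : ℝ) + 1) else 0) + √q ^ u / √m := by
    intro u _
    have hu : 0 < √((u : ℝ) + 1) := Real.sqrt_pos.2 (by positivity)
    rw [hpow]
    by_cases hum : u ∈ Finset.range m
    · rw [if_pos hum]
      have : √q ^ (u + 1) / √((u : ℝ) + 1) ≤ 1 / √((u : ℝ) + 1) := by
        gcongr
        exact pow_le_one₀ hr0 hr1.le
      have : 0 ≤ √q ^ u / √m := by positivity
      linarith
    · rw [if_neg hum, zero_add]
      rw [Finset.mem_range, not_lt] at hum
      refine div_le_div₀ (by positivity) ?_ hsm (Real.sqrt_le_sqrt ?_)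
      · rw [pow_succ]
        exact mul_le_of_le_one_right (by positivity) hr1.le
      · have : (m : ℝ) ≤ u := by exact_mod_cast hum
        linarith
  refine (Finset.sum_le_sum hterm).trans ?_
  rw [Finset.sum_add_distrib, ← Finset.sum_div]
  have hA : ∑ u ∈ Finset.range n, (if u ∈ Finset.range m then 1 / √((u : ℝ) + 1) else 0)
      ≤ 2 * √m := by
    refine le_trans ?_ (sum_inv_sqrt_le m)
    rw [← Finset.sum_filter]
    refine Finset.sum_le_sum_of_subset_of_nonneg (fun u hu => (Finset.mem_filter.1 hu).2) ?_
    intros; positivity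
  have hG : ∑ u ∈ Finset.range n, √q ^ u ≤ 2 * m := by
    have h1 : 0 < 1 - √q := by linarith
    have h2 : (∑ u ∈ Finset.range n, √q ^ u) * (1 - √q) ≤ 1 := by
      rw [geom_sum_mul_neg]
      have := pow_nonneg hr0 n
      linarith
    have h3 : (∑ u ∈ Finset.range n, √q ^ u) ≤ 1 / (1 - √q) := by rwa [le_div_iff₀ h1]
    refine h3.trans ?_
    rw [div_le_iff₀ h1]
    have h4 : (m : ℝ) * (1 - q) = 1 := by
      rw [hq]; field_simp; ring
    have h5 : (1 - √q) * (1 + √q) = 1 - q := by linear_combination -hrr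
    nlinarith
  have hB : (∑ u ∈ Finset.range n, √q ^ u) / √m ≤ 2 * √m := by
    rw [div_le_iff₀ hsm]
    refine hG.trans (le_of_eq ?_)
    rw [mul_assoc, Real.mul_self_sqrt (by linarith)]
  linarith

/-! ### Conditional means given the future, and factorization of the mean of a product. -/

/-- The mean of `f` under the geometric distribution with success probability `1 / m`, written as
`f 1` plus the increments of `f` weighted with the tail probabilities. -/
noncomputable def geomMean (m : ℕ) (f : ℕ → ℂ) : ℂ :=
  f 1 + ∑' u : ℕ, (f (u + 2) - f (u + 1)) * ((1 - 1 / (m : ℝ) : ℝ) : ℂ) ^ (u + 1)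

section Uniform

variable {Ω B : Type*} [MeasurableSpace Ω] {P : Measure Ω} [IsProbabilityMeasure P]
  [Fintype B] [MeasurableSpace B] [MeasurableSingletonClass B] {X : ℕ → Ω → B}

/-- The mean of `f` over the hitting times of all symbols, which is the conditional mean of
`f (return time)` given the future. -/
noncomputable def hitMean (X : ℕ → Ω → B) (f : ℕ → ℂ) (j : ℕ) (ω : Ω) : ℂ :=
  (∑ a, f (hit X j a ω)) / Fintype.card B

theorem measurable_hitMean_future (f : ℕ → ℂ) (j : ℕ) :
    Measurable[future X j] (hitMean X f j) :=
  (Finset.measurable_fun_sum _ fun a _ =>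
    (measurable_from_top (f := f)).comp (measurable_hit_future j a)).div_const _

theorem norm_hitMean_le {f : ℕ → ℂ} (hf : ∀ w, ‖f w‖ ≤ 1) (j : ℕ) (ω : Ω) :
    ‖hitMean X f j ω‖ ≤ 1 := by
  rw [hitMean, norm_div, Complex.norm_natCast]
  refine div_le_one_of_le₀ ?_ (Nat.cast_nonneg _)
  refine (norm_sum_le_of_le _ fun a _ => hf (hit X j a ω)).trans ?_
  simp

/-- Both means are sums of the same increments of `f`, weighted by the unseen fraction and by its
expectation respectively. The L¹ bounds on the differences of weights are then summed over `u`. -/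
theorem IsUniformSequence.integral_norm_hitMean_sub_le (hX : IsUniformSequence X P)
    (hB : 2 ≤ Fintype.card B) {f : ℕ → ℂ} {s : ℝ}
    (hs : ∀ u : ℕ, ‖f (u + 2) - f (u + 1)‖ ≤ s / (u + 1)) (j : ℕ) :
    ∫ ω, ‖hitMean X f j ω - geomMean (Fintype.card B) f‖ ∂P ≤ 4 * s / √(Fintype.card B) := by
  have hs0 : 0 ≤ s := by simpa using (norm_nonneg _).trans (hs 0)
  have hm2 : (2 : ℝ) ≤ (Fintype.card B : ℝ) := by exact_mod_cast hB
  set m : ℕ := Fintype.card B with hm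
  set q : ℝ := 1 - 1 / (m : ℝ) with hq
  have hm0 : (m : ℂ) ≠ 0 := by
    have : m ≠ 0 := by omega
    exact_mod_cast this
  have hq0 : 0 ≤ q := by
    rw [hq, sub_nonneg, div_le_one (by linarith)]; linarith
  have hq1 : q < 1 := by
    have : 0 < 1 / (m : ℝ) := by positivity
    linarith
  have hsum : Summable fun u : ℕ => (f (u + 2) - f (u + 1)) * (q : ℂ) ^ (u + 1) := by
    refine Summable.of_norm_bounded ((summable_geometric_of_lt_one hq0 hq1).mul_left s) fun u => ?_
    rw [norm_mul, norm_pow, Complex.norm_real, Real.norm_of_nonneg hq0]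
    refine mul_le_mul ((hs u).trans (div_le_self hs0 (by linarith [u.cast_nonneg (α := ℝ)])))
      (pow_le_pow_of_le_one hq0 hq1.le (Nat.le_succ u)) (by positivity) hs0
  have hae : ∀ᵐ ω ∂P, HasSum
      (fun u => (f (u + 2) - f (u + 1)) * ((unseen X j (u + 1) ω - q ^ (u + 1) : ℝ) : ℂ))
      (hitMean X f j ω - geomMean m f) := by
    filter_upwards [hX.ae_exists_hit (by omega) j] with ω hω
    have h1 := (hasSum_sum fun a (_ : a ∈ Finset.univ) =>
      hasSum_increments_hit f (hω a)).div_const (m : ℂ)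
    have h2 := h1.sub hsum.hasSum
    have e1 : (∑ a, (f (hit X j a ω) - f 1)) / (m : ℂ)
        - ∑' u : ℕ, (f (u + 2) - f (u + 1)) * (q : ℂ) ^ (u + 1)
        = hitMean X f j ω - geomMean m f := by
      simp only [hitMean, geomMean, Finset.sum_sub_distrib, Finset.sum_const, Finset.card_univ,
        nsmul_eq_mul, ← hm, ← hq]
      field_simp
      ring
    rw [e1] at h2
    refine h2.congr_fun ?_
    intro u
    simp only [unseen, ← hm, ← Finset.mul_sum]
    push_cast
    rw [mul_sub, mul_div_assoc]
    congr 3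
    refine Finset.sum_congr rfl fun a _ => ?_
    by_cases h : ω ∈ avoid X j {a} (u + 1) <;> simp [h]
  have hbound : ∀ u : ℕ, ∫⁻ ω, ‖(f (u + 2) - f (u + 1)) *
      ((unseen X j (u + 1) ω - q ^ (u + 1) : ℝ) : ℂ)‖ₑ ∂P
      ≤ ENNReal.ofReal (s / m * (√(q ^ (u + 1)) / √((u : ℝ) + 1))) := by
    intro u
    have hint : Integrable (fun ω => |unseen X j (u + 1) ω - q ^ (u + 1)|) P := by
      refine Integrable.abs ((Integrable.of_bound (measurable_unseen hX j (u + 1)).aestronglyMeasurable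
        1 (ae_of_all _ fun ω => ?_)).sub (integrable_const _))
      rw [Real.norm_of_nonneg (unseen_nonneg _ _ ω)]
      exact unseen_le_one _ _ ω
    have e : ∀ ω, ‖(f (u + 2) - f (u + 1)) * ((unseen X j (u + 1) ω - q ^ (u + 1) : ℝ) : ℂ)‖ₑ
        = ENNReal.ofReal (‖f (u + 2) - f (u + 1)‖ * |unseen X j (u + 1) ω - q ^ (u + 1)|) := by
      intro ω
      rw [← ofReal_norm, norm_mul, Complex.norm_real, Real.norm_eq_abs]
    simp_rw [e]
    rw [← ofReal_integral_eq_lintegral_ofReal (hint.const_mul _)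
      (ae_of_all _ fun ω => by positivity), integral_const_mul]
    refine ENNReal.ofReal_le_ofReal ?_
    refine (mul_le_mul (hs u) (hX.integral_abs_unseen_sub_le hB j (u + 1))
      (integral_nonneg fun _ => abs_nonneg _) (by positivity)).trans (le_of_eq ?_)
    rw [← hm, ← hq, Real.sqrt_mul (by positivity)]
    push_cast
    have hu : 0 < √((u : ℝ) + 1) := Real.sqrt_pos.2 (by positivity)
    have hu2 : (u : ℝ) + 1 = √((u : ℝ) + 1) * √((u : ℝ) + 1) :=
      (Real.mul_self_sqrt (by positivity)).symm
    rw [div_mul_div_comm, div_mul_div_comm, div_eq_div_iff (by positivity) (by positivity)]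
    nth_rewrite 3 [hu2]
    ring
  have hfin : ∫⁻ ω, ‖hitMean X f j ω - geomMean m f‖ₑ ∂P ≤ ENNReal.ofReal (4 * s / √m) := by
    calc ∫⁻ ω, ‖hitMean X f j ω - geomMean m f‖ₑ ∂P
        ≤ ∫⁻ ω, ∑' u : ℕ, ‖(f (u + 2) - f (u + 1)) *
            ((unseen X j (u + 1) ω - q ^ (u + 1) : ℝ) : ℂ)‖ₑ ∂P := by
          refine lintegral_mono_ae ?_
          filter_upwards [hae] with ω hω
          rw [← hω.tsum_eq]
          exact enorm_tsum_le_tsum_enorm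
      _ = ∑' u : ℕ, ∫⁻ ω, ‖(f (u + 2) - f (u + 1)) *
            ((unseen X j (u + 1) ω - q ^ (u + 1) : ℝ) : ℂ)‖ₑ ∂P := by
          refine lintegral_tsum fun u => ?_
          have := measurable_unseen hX j (u + 1)
          fun_prop
      _ ≤ ENNReal.ofReal (4 * s / √m) := by
          refine ENNReal.tsum_le_of_sum_range_le fun n => ?_
          refine (Finset.sum_le_sum fun u _ => hbound u).trans ?_
          rw [← ENNReal.ofReal_sum_of_nonneg fun u _ => by positivity, ← Finset.mul_sum]
          refine ENNReal.ofReal_le_ofReal ?_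
          refine (mul_le_mul_of_nonneg_left (sum_sqrt_pow_div_sqrt_le (m := m) (by omega) n)
            (by positivity)).trans (le_of_eq ?_)
          have hsm : 0 < √(m : ℝ) := Real.sqrt_pos.2 (by linarith)
          have hmm : (m : ℝ) = √m * √m := (Real.mul_self_sqrt (by positivity)).symm
          rw [div_mul_eq_mul_div, div_eq_div_iff (by positivity) (by positivity)]
          nth_rewrite 3 [hmm]
          ring
  have hmeas : Measurable (hitMean X f j) :=
    (measurable_hitMean_future f j).mono (hX.future_le j) le_rfl
  rw [integral_norm_eq_lintegral_enorm (hmeas.sub_const _).aestronglyMeasurable]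
  exact ENNReal.toReal_le_of_le_ofReal (by positivity) hfin

theorem measurable_return_future {i j : ℕ} (h : i < j) :
    Measurable[future X i] fun ω => hit X j (X j ω) ω := by
  let := future X i
  refine measurable_sInf_nat fun t => ?_
  have h1 := measurable_future (X := X) (show i < j + t by omega)
  have h2 := measurable_future (X := X) h
  by_cases ht : 1 ≤ t
  · simp only [ht, true_and]
    exact measurableSet_eq_fun h1 h2
  · simp [ht]

/-- Given the later entries, the return time of an entry is distributed as the hitting time of a
uniformly chosen symbol. -/
theorem IsUniformSequence.integral_return_mul (hX : IsUniformSequence X P) {f : ℕ → ℂ}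
    (hf : ∀ w, ‖f w‖ ≤ 1) (j : ℕ) {R : Ω → ℂ} (hR : Measurable[future X j] R)
    (hR1 : ∀ ω, ‖R ω‖ ≤ 1) :
    ∫ ω, f (hit X j (X j ω) ω) * R ω ∂P = ∫ ω, hitMean X f j ω * R ω ∂P := by
  classical
  have hle := hX.future_le j
  have hY : ∀ a, Measurable[future X j] fun ω => f (hit X j a ω) * R ω := fun a =>
    Measurable.mul ((measurable_from_top (f := f)).comp (measurable_hit_future j a)) hR
  have hY1 : ∀ a ω, ‖f (hit X j a ω) * R ω‖ ≤ 1 := fun a ω => by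
    rw [norm_mul]; exact mul_le_one₀ (hf _) (norm_nonneg _) (hR1 _)
  have hYi : ∀ a, Integrable (fun ω => f (hit X j a ω) * R ω) P := fun a =>
    Integrable.of_bound ((hY a).mono hle le_rfl).aestronglyMeasurable 1 (ae_of_all _ (hY1 a))
  have hind : ∀ a, ∫ ω, (if X j ω = a then (1 : ℂ) else 0) * (f (hit X j a ω) * R ω) ∂P
      = 1 / (Fintype.card B : ℂ) * ∫ ω, f (hit X j a ω) * R ω ∂P := by
    intro a
    have hIF : IndepFun (X j) (fun ω => f (hit X j a ω) * R ω) P := by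
      rw [IndepFun_iff_Indep]
      exact indep_of_indep_of_le_right (hX.indep j) (hY a).comap_le
    have hg : Measurable fun b : B => if b = a then (1 : ℂ) else 0 := measurable_of_finite _
    have := hIF.integral_fun_comp_mul_comp (𝕜 := ℂ) (f := fun b => if b = a then (1 : ℂ) else 0)
      (g := id) (hX.measurable j).aemeasurable ((hY a).mono hle le_rfl).aemeasurable
      hg.aestronglyMeasurable measurable_id.aestronglyMeasurable
    simp only [id] at this
    rw [this]
    congr 1
    have e : (fun ω => if X j ω = a then (1 : ℂ) else 0) = (X j ⁻¹' {a}).indicator fun _ => 1 := by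
      ext ω; simp [Set.indicator_apply]
    rw [e, integral_indicator_const _ (hX.measurable j (measurableSet_singleton a)), hX.uniform]
    simp
  -- Once the value of `X j` is fixed to be `a`, the hitting time depends on the future only, and
  -- independence applies to each summand.
  have hsplit : ∀ ω, f (hit X j (X j ω) ω) * R ω
      = ∑ a, (if X j ω = a then (1 : ℂ) else 0) * (f (hit X j a ω) * R ω) := by
    intro ω
    simp
  simp_rw [hsplit]
  rw [integral_finsetSum]
  · simp_rw [hind, hitMean, div_mul_eq_mul_div (_ : ℂ) _ (R _), Finset.sum_mul]
    rw [integral_div, integral_finsetSum _ fun a _ => hYi a, ← Finset.mul_sum]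
    ring
  · intro a _
    refine Integrable.of_bound (Measurable.aestronglyMeasurable ?_) 1 (ae_of_all _ fun ω => ?_)
    · exact ((measurable_of_finite fun b : B => if b = a then (1 : ℂ) else 0).comp
        (hX.measurable j)).mul ((hY a).mono hle le_rfl)
    · rw [norm_mul]
      refine mul_le_one₀ ?_ (norm_nonneg _) (hY1 a ω)
      split_ifs <;> simp

/-- Comparison of the mean of a product of functions of return times with the product of means. -/
theorem IsUniformSequence.norm_integral_prod_return_sub_pow_le (hX : IsUniformSequence X P)
    {f : ℕ → ℂ} (hf : ∀ w, ‖f w‖ ≤ 1) {g : ℂ} (hg : ‖g‖ ≤ 1) {δ : ℝ}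
    (hδ : ∀ j, ∫ ω, ‖hitMean X f j ω - g‖ ∂P ≤ δ) (n i : ℕ) :
    ‖∫ ω, ∏ j ∈ Finset.range n, f (hit X (i + j) (X (i + j) ω) ω) ∂P - g ^ n‖ ≤ n * δ := by
  induction n generalizing i with
  | zero => simp
  | succ n ih =>
    set R : Ω → ℂ := fun ω => ∏ j ∈ Finset.range n, f (hit X (i + 1 + j) (X (i + 1 + j) ω) ω)
      with hRdef
    have hR : Measurable[future X i] R := by
      refine Finset.measurable_fun_prod _ fun j _ => ?_
      exact (measurable_from_top (f := f)).comp
        (measurable_return_future (X := X) (show i < i + 1 + j by omega))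
    have hR1 : ∀ ω, ‖R ω‖ ≤ 1 := fun ω => by
      rw [hRdef, norm_prod]
      exact Finset.prod_le_one (fun _ _ => norm_nonneg _) fun _ _ => hf _
    have hRm := hR.mono (hX.future_le i) le_rfl
    have hMm : Measurable (hitMean X f i) :=
      (measurable_hitMean_future f i).mono (hX.future_le i) le_rfl
    have hRi : Integrable R P := Integrable.of_bound hRm.aestronglyMeasurable 1 (ae_of_all _ hR1)
    have hMi : Integrable (hitMean X f i) P :=
      Integrable.of_bound hMm.aestronglyMeasurable 1 (ae_of_all _ (norm_hitMean_le hf i))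
    have hMRi : Integrable (fun ω => hitMean X f i ω * R ω) P :=
      Integrable.of_bound (hMm.mul hRm).aestronglyMeasurable 1 (ae_of_all _ fun ω => by
        rw [norm_mul]; exact mul_le_one₀ (norm_hitMean_le hf i ω) (norm_nonneg _) (hR1 ω))
    have hprod : ∀ ω, ∏ j ∈ Finset.range (n + 1), f (hit X (i + j) (X (i + j) ω) ω)
        = f (hit X i (X i ω) ω) * R ω := fun ω => by
      rw [Finset.prod_range_succ', mul_comm, hRdef]
      simp only [add_zero]
      congr 1
      refine Finset.prod_congr rfl fun j _ => ?_
      rw [show i + (j + 1) = i + 1 + j by ring]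
    simp_rw [hprod]
    rw [hX.integral_return_mul hf i hR hR1]
    -- Replacing the conditional mean of the earliest factor by `g` costs `δ`, since the remaining
    -- product is bounded by `1`.
    have h1 : ‖∫ ω, (hitMean X f i ω - g) * R ω ∂P‖ ≤ δ := by
      refine (norm_integral_le_integral_norm _).trans (le_trans ?_ (hδ i))
      refine integral_mono_of_nonneg (ae_of_all _ fun _ => norm_nonneg _)
        (hMi.sub (integrable_const g)).norm (ae_of_all _ fun ω => ?_)
      simp only [norm_mul]
      exact mul_le_of_le_one_right (norm_nonneg _) (hR1 ω)
    have h2 : ∫ ω, hitMean X f i ω * R ω ∂P - g ^ (n + 1)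
        = ∫ ω, (hitMean X f i ω - g) * R ω ∂P + g * (∫ ω, R ω ∂P - g ^ n) := by
      simp_rw [sub_mul]
      rw [integral_sub hMRi (hRi.const_mul g), integral_const_mul]
      ring
    rw [h2]
    refine (norm_add_le _ _).trans ?_
    rw [norm_mul]
    have h3 : ‖g‖ * ‖∫ ω, R ω ∂P - g ^ n‖ ≤ n * δ :=
      (mul_le_of_le_one_left (norm_nonneg _) hg).trans (ih (i + 1))
    push_cast
    linarith

end Uniform

/-! ### From the geometric to the exponential distribution. -/

theorem norm_exp_mul_I_sub_le (a b : ℝ) :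
    ‖Complex.exp (Complex.I * a) - Complex.exp (Complex.I * b)‖ ≤ |a - b| := by
  have h : Complex.exp (Complex.I * a) - Complex.exp (Complex.I * b)
      = Complex.exp (Complex.I * b) * (Complex.exp (Complex.I * (a - b : ℝ)) - 1) := by
    rw [mul_sub, ← Complex.exp_add, mul_one]
    congr 2
    push_cast
    ring
  rw [h, norm_mul, mul_comm Complex.I (b : ℂ), Complex.norm_exp_ofReal_mul_I, one_mul]
  exact Real.norm_exp_I_mul_ofReal_sub_one_le

/-- The function `w ↦ exp (i s (log w - log m + γ))`. -/
noncomputable def logPhase (m : ℕ) (s : ℝ) (w : ℕ) : ℂ :=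
  Complex.exp (Complex.I * (s * (Real.log w - Real.log m + Real.eulerMascheroniConstant) : ℝ))

theorem norm_logPhase (m : ℕ) (s : ℝ) (w : ℕ) : ‖logPhase m s w‖ = 1 := by
  rw [logPhase, mul_comm, Complex.norm_exp_ofReal_mul_I]

theorem norm_logPhase_sub_le (m : ℕ) (s : ℝ) (u : ℕ) :
    ‖logPhase m s (u + 2) - logPhase m s (u + 1)‖ ≤ |s| / (u + 1) := by
  refine (norm_exp_mul_I_sub_le _ _).trans ?_
  have hu : (0 : ℝ) < u + 1 := by positivity
  have e : s * (Real.log ((u + 2 : ℕ) : ℝ) - Real.log m + Real.eulerMascheroniConstant)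
      - s * (Real.log ((u + 1 : ℕ) : ℝ) - Real.log m + Real.eulerMascheroniConstant)
      = s * Real.log (1 + 1 / ((u : ℝ) + 1)) := by
    have : 1 + 1 / ((u : ℝ) + 1) = ((u + 2 : ℕ) : ℝ) / ((u + 1 : ℕ) : ℝ) := by
      push_cast; field_simp; ring
    rw [this, Real.log_div (by positivity) (by positivity)]
    ring
  rw [e, abs_mul, div_eq_mul_one_div |s|]
  refine mul_le_mul_of_nonneg_left ?_ (abs_nonneg s)
  rw [abs_of_nonneg (Real.log_nonneg (by have : 0 ≤ 1 / ((u : ℝ) + 1) := by positivity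
                                         linarith))]
  have := Real.log_le_sub_one_of_pos (show 0 < 1 + 1 / ((u : ℝ) + 1) by positivity)
  linarith

/-- Used with `z = c/x`: the bound `log (1 + z) ≤ z` would give `1/x`, not integrable at `0`,
whereas `x^{-1/2}` is. -/
theorem log_one_add_le_two_mul_sqrt {z : ℝ} (hz : 0 ≤ z) : Real.log (1 + z) ≤ 2 * √z := by
  have h0 := Real.sqrt_nonneg z
  have h1 : 1 + z ≤ (1 + √z) ^ 2 := by nlinarith [Real.sq_sqrt hz]
  have h2 := Real.log_le_log (by positivity) h1
  rw [Real.log_pow] at h2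
  have h3 := Real.log_le_sub_one_of_pos (show 0 < 1 + √z by positivity)
  push_cast at h2
  linarith

theorem iUnion_Ico_nat_mul {c : ℝ} (hc : 0 < c) :
    ⋃ n : ℕ, Set.Ico (n * c) ((n + 1) * c) = Set.Ici 0 := by
  ext x
  simp only [Set.mem_iUnion, Set.mem_Ico, Set.mem_Ici]
  constructor
  · rintro ⟨n, h, -⟩
    exact le_trans (by positivity) h
  · intro hx
    refine ⟨⌊x / c⌋₊, ?_, ?_⟩
    · rw [← le_div_iff₀ hc]; exact Nat.floor_le (by positivity)
    · rw [← div_lt_iff₀ hc]; exact Nat.lt_floor_add_one _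

/-- A geometric random variable is obtained by rounding up an exponential one. -/
theorem geomMean_eq_integral {m : ℕ} (hm : 2 ≤ m) {f : ℕ → ℂ} (hf : ∀ w, ‖f w‖ ≤ 1) {c : ℝ}
    (hc : c = -Real.log (1 - 1 / (m : ℝ))) :
    geomMean m f = ∫ x in Set.Ioi (0 : ℝ), (Real.exp (-x) : ℂ) * f (⌊x / c⌋₊ + 1) := by
  have hm2 : (2 : ℝ) ≤ (m : ℝ) := by exact_mod_cast hm
  set q : ℝ := 1 - 1 / (m : ℝ) with hq
  have hq0 : 0 < q := by
    rw [hq, sub_pos, div_lt_one (by linarith)]; linarith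
  have hq1 : q < 1 := by
    have : 0 < 1 / (m : ℝ) := by positivity
    linarith
  have hc0 : 0 < c := by
    rw [hc, neg_pos]; exact Real.log_neg hq0 hq1
  have hexp : ∀ n : ℕ, Real.exp (-(n * c)) = q ^ n := fun n => by
    rw [hc, mul_neg, neg_neg, Real.exp_nat_mul, Real.exp_log hq0]
  have hs1 : Summable fun u : ℕ => (q : ℂ) ^ u * f (u + 1) := by
    refine Summable.of_norm_bounded (summable_geometric_of_lt_one hq0.le hq1) fun u => ?_
    rw [norm_mul, norm_pow, Complex.norm_real, Real.norm_of_nonneg hq0.le]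
    exact mul_le_of_le_one_right (by positivity) (hf _)
  have hs2 : Summable fun u : ℕ => (q : ℂ) ^ (u + 1) * f (u + 1) := by
    simpa [pow_succ, mul_assoc, mul_comm, mul_left_comm] using hs1.mul_left (q : ℂ)
  have hs3 : Summable fun u : ℕ => (q : ℂ) ^ (u + 1) * f (u + 2) :=
    (summable_nat_add_iff 1).2 hs1
  -- Summation by parts turns tail probabilities into the point masses `q^u - q^(u+1)` of the value
  -- `u + 1`.
  have habel : geomMean m f = ∑' u : ℕ, ((q : ℂ) ^ u - (q : ℂ) ^ (u + 1)) * f (u + 1) := by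
    have e1 : ∑' u : ℕ, ((q : ℂ) ^ u - (q : ℂ) ^ (u + 1)) * f (u + 1)
        = ∑' u : ℕ, (q : ℂ) ^ u * f (u + 1) - ∑' u : ℕ, (q : ℂ) ^ (u + 1) * f (u + 1) := by
      rw [← hs1.tsum_sub hs2]
      exact tsum_congr fun u => sub_mul _ _ _
    have e2 : geomMean m f = f 1 + (∑' u : ℕ, (q : ℂ) ^ (u + 1) * f (u + 2)
        - ∑' u : ℕ, (q : ℂ) ^ (u + 1) * f (u + 1)) := by
      rw [geomMean, ← hq, ← hs3.tsum_sub hs2]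
      congr 1
      exact tsum_congr fun u => by ring
    rw [e1, e2, hs1.tsum_eq_zero_add]
    simp only [pow_zero, one_mul, zero_add]
    ring
  have hmeas : Measurable fun x : ℝ => (Real.exp (-x) : ℂ) * f (⌊x / c⌋₊ + 1) := by
    refine Measurable.mul (by fun_prop) ((measurable_from_top (f := fun n => f (n + 1))).comp ?_)
    exact Nat.measurable_floor.comp (measurable_id.div_const c)
  have hint : IntegrableOn (fun x : ℝ => (Real.exp (-x) : ℂ) * f (⌊x / c⌋₊ + 1))
      (Set.Ici 0) := by
    rw [integrableOn_Ici_iff_integrableOn_Ioi]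
    have := exp_neg_integrableOn_Ioi 0 one_pos
    simp only [neg_mul, one_mul] at this
    refine Integrable.mono' this hmeas.aestronglyMeasurable (ae_of_all _ fun x => ?_)
    rw [norm_mul, Complex.norm_real, Real.norm_of_nonneg (Real.exp_pos _).le]
    exact mul_le_of_le_one_right (Real.exp_pos _).le (hf _)
  rw [habel, ← integral_Ici_eq_integral_Ioi, ← iUnion_Ico_nat_mul hc0]
  refine HasSum.tsum_eq ?_
  have hpart : ∀ n : ℕ, ∫ x in Set.Ico (n * c) ((n + 1) * c),
      (Real.exp (-x) : ℂ) * f (⌊x / c⌋₊ + 1)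
      = ((q : ℂ) ^ n - (q : ℂ) ^ (n + 1)) * f (n + 1) := by
    intro n
    have hle : n * c ≤ (n + 1) * c := by linarith
    have e : ∫ x in Set.Ico (n * c) ((n + 1) * c), (Real.exp (-x) : ℂ) * f (⌊x / c⌋₊ + 1)
        = ∫ x in Set.Ico (n * c) ((n + 1) * c), (Real.exp (-x) : ℂ) * f (n + 1) := by
      refine setIntegral_congr_fun measurableSet_Ico fun x hx => ?_
      have : ⌊x / c⌋₊ = n := by
        rw [Nat.floor_eq_iff (div_nonneg (le_trans (by positivity) hx.1) hc0.le),
          le_div_iff₀ hc0, div_lt_iff₀ hc0]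
        exact hx
      simp only [this]
    rw [e, integral_mul_const, integral_Ico_eq_integral_Ioc,
      ← intervalIntegral.integral_of_le hle, intervalIntegral.integral_ofReal]
    congr 1
    rw [intervalIntegral.integral_comp_neg (fun x => Real.exp x), integral_exp, hexp]
    have := hexp (n + 1)
    push_cast at this
    rw [this]
    push_cast
    rfl
  have := hasSum_integral_iUnion (μ := volume) (s := fun n : ℕ => Set.Ico (n * c) ((n + 1) * c))
    (f := fun x : ℝ => (Real.exp (-x) : ℂ) * f (⌊x / c⌋₊ + 1))
    (fun _ => measurableSet_Ico) ?_ ?_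
  · simp_rw [hpart] at this
    exact this
  · intro i j hij
    refine Set.disjoint_left.2 fun x hi hj => hij ?_
    have h1 : ((i : ℝ)) * c < (j + 1) * c := lt_of_le_of_lt hi.1 hj.2
    have h2 : ((j : ℝ)) * c < (i + 1) * c := lt_of_le_of_lt hj.1 hi.2
    have h1 := lt_of_mul_lt_mul_right h1 hc0.le
    have h2 := lt_of_mul_lt_mul_right h2 hc0.le
    norm_cast at h1 h2
    omega
  · rw [iUnion_Ico_nat_mul hc0]
    exact hint

/-- The characteristic function of the centred logarithm of an exponential random variable. -/
noncomputable def logExpChar (s : ℝ) : ℂ :=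
  Complex.exp (Real.eulerMascheroniConstant * (Complex.I * s)) * Complex.Gamma (1 + Complex.I * s)

theorem logExpChar_eq_integral (s : ℝ) :
    logExpChar s = ∫ x in Set.Ioi (0 : ℝ), (Real.exp (-x) : ℂ) *
      Complex.exp (Complex.I * (s * (Real.log x + Real.eulerMascheroniConstant) : ℝ)) := by
  rw [logExpChar, Complex.Gamma_eq_integral (by simp), Complex.GammaIntegral,
    ← integral_const_mul]
  refine setIntegral_congr_fun measurableSet_Ioi fun x hx => ?_
  have hx0 : (x : ℂ) ≠ 0 := by exact_mod_cast (ne_of_gt hx)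
  rw [add_sub_cancel_left, Complex.cpow_def_of_ne_zero hx0, ← Complex.ofReal_log (le_of_lt hx),
    mul_left_comm, ← Complex.exp_add]
  congr 2
  push_cast
  ring

theorem norm_logExpChar_le (s : ℝ) : ‖logExpChar s‖ ≤ 1 := by
  rw [logExpChar_eq_integral]
  refine (norm_integral_le_integral_norm _).trans ?_
  simp_rw [norm_mul, mul_comm Complex.I, Complex.norm_exp_ofReal_mul_I, Complex.norm_real,
    Real.norm_of_nonneg (Real.exp_pos _).le, mul_one]
  rw [integral_exp_neg_Ioi_zero]

/-- Under the coupling `N = ⌊x/c⌋ + 1`, the logarithms of `N/m` and `x` differ by the rounding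
error, at most `log (1 + c/x) ≤ 2√(c/x)`, and by `log (m c) ≤ 2/m`. Integrating the former against
`e^{-x}` gives `Γ(1/2) = √π`. -/
theorem norm_geomMean_logPhase_sub_le {m : ℕ} (hm : 2 ≤ m) (s : ℝ) :
    ‖geomMean m (logPhase m s) - logExpChar s‖ ≤ 8 * |s| / √m := by
  have hm2 : (2 : ℝ) ≤ (m : ℝ) := by exact_mod_cast hm
  set q : ℝ := 1 - 1 / (m : ℝ) with hq
  set c : ℝ := -Real.log q with hc
  have hq0 : 0 < q := by
    rw [hq, sub_pos, div_lt_one (by linarith)]; linarith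
  have hc1 : 1 / (m : ℝ) ≤ c := by
    have := Real.log_le_sub_one_of_pos hq0
    linarith
  have hc0 : 0 < c := lt_of_lt_of_le (by positivity) hc1
  have hc2 : c ≤ 1 / ((m : ℝ) - 1) := by
    have h := Real.log_le_sub_one_of_pos (inv_pos.2 hq0)
    rw [Real.log_inv] at h
    refine h.trans (le_of_eq ?_)
    have : (m : ℝ) - 1 ≠ 0 := by linarith
    have hq' : q = ((m : ℝ) - 1) / m := by rw [hq]; field_simp
    rw [hq', inv_div]
    field_simp
    ring
  have hm1 : 1 / ((m : ℝ) - 1) ≤ 2 / m := by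
    rw [div_le_div_iff₀ (by linarith) (by linarith)]; linarith
  have hmc : 1 ≤ m * c := by
    rw [div_le_iff₀ (by linarith)] at hc1; linarith
  have hlog0 : 0 ≤ Real.log (m * c) := Real.log_nonneg hmc
  have hlog1 : Real.log (m * c) ≤ 2 / m := by
    have h1 := Real.log_le_sub_one_of_pos (show 0 < m * c by linarith)
    have h2 : m * c ≤ m * (1 / ((m : ℝ) - 1)) := by gcongr
    have h3 : m * (1 / ((m : ℝ) - 1)) = 1 + 1 / ((m : ℝ) - 1) := by
      have : (m : ℝ) - 1 ≠ 0 := by linarith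
      field_simp
      ring
    linarith
  have hpt : ∀ x ∈ Set.Ioi (0 : ℝ),
      ‖(Real.exp (-x) : ℂ) * logPhase m s (⌊x / c⌋₊ + 1) - (Real.exp (-x) : ℂ) *
        Complex.exp (Complex.I * (s * (Real.log x + Real.eulerMascheroniConstant) : ℝ))‖
      ≤ |s| * (2 * √c * (Real.exp (-x) * x ^ ((1 / 2 : ℝ) - 1)) + 2 / m * Real.exp (-x)) := by
    intro x hx
    have hx : 0 < x := hx
    set y := x / c with hy
    have hy0 : 0 < y := div_pos hx hc0
    have hN0 : (0 : ℝ) < ((⌊y⌋₊ + 1 : ℕ) : ℝ) := by positivity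
    have hlow : 0 ≤ Real.log ((⌊y⌋₊ + 1 : ℕ) : ℝ) - Real.log y := by
      rw [sub_nonneg]
      refine Real.log_le_log hy0 ?_
      push_cast
      exact (Nat.lt_floor_add_one y).le
    have hupp : Real.log ((⌊y⌋₊ + 1 : ℕ) : ℝ) - Real.log y ≤ 2 * (√c * x ^ ((1 / 2 : ℝ) - 1)) := by
      have h1 : Real.log ((⌊y⌋₊ + 1 : ℕ) : ℝ) ≤ Real.log (y + 1) := by
        refine Real.log_le_log hN0 ?_
        push_cast
        linarith [Nat.floor_le hy0.le]
      have h2 : Real.log (y + 1) - Real.log y = Real.log (1 + c / x) := by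
        rw [← Real.log_div (by positivity) (by positivity)]
        congr 1
        rw [hy]
        field_simp
      have h3 := log_one_add_le_two_mul_sqrt (show 0 ≤ c / x by positivity)
      have h4 : √(c / x) = √c * x ^ ((1 / 2 : ℝ) - 1) := by
        rw [Real.sqrt_div hc0.le, show (1 / 2 : ℝ) - 1 = -(1 / 2) by norm_num,
          Real.rpow_neg hx.le, ← Real.sqrt_eq_rpow, div_eq_mul_inv]
      rw [h4] at h3
      linarith
    have hlogs : Real.log x = Real.log (m * c) - Real.log m + Real.log y := by
      rw [hy, Real.log_div hx.ne' hc0.ne', Real.log_mul (by positivity) hc0.ne']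
      ring
    rw [← mul_sub, norm_mul, Complex.norm_real, Real.norm_of_nonneg (Real.exp_pos _).le]
    have h5 := norm_exp_mul_I_sub_le
      (s * (Real.log ((⌊y⌋₊ + 1 : ℕ) : ℝ) - Real.log m + Real.eulerMascheroniConstant))
      (s * (Real.log x + Real.eulerMascheroniConstant))
    rw [← mul_sub, abs_mul] at h5
    have h6 : |Real.log ((⌊y⌋₊ + 1 : ℕ) : ℝ) - Real.log m + Real.eulerMascheroniConstant
        - (Real.log x + Real.eulerMascheroniConstant)|
        ≤ 2 * (√c * x ^ ((1 / 2 : ℝ) - 1)) + 2 / m := by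
      rw [hlogs, abs_le]
      have : 0 ≤ 2 * (√c * x ^ ((1 / 2 : ℝ) - 1)) := by positivity
      constructor <;> linarith
    calc _ ≤ Real.exp (-x) * (|s| * (2 * (√c * x ^ ((1 / 2 : ℝ) - 1)) + 2 / m)) := by
          refine mul_le_mul_of_nonneg_left (h5.trans ?_) (Real.exp_pos _).le
          exact mul_le_mul_of_nonneg_left h6 (abs_nonneg s)
      _ = _ := by ring
  have hexpi : IntegrableOn (fun x : ℝ => Real.exp (-x)) (Set.Ioi 0) := by
    have := exp_neg_integrableOn_Ioi 0 one_pos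
    simpa only [neg_mul, one_mul] using this
  have hgami : IntegrableOn (fun x : ℝ => Real.exp (-x) * x ^ ((1 / 2 : ℝ) - 1)) (Set.Ioi 0) :=
    Real.GammaIntegral_convergent (by norm_num)
  have hi1 : IntegrableOn (fun x : ℝ => (Real.exp (-x) : ℂ) * logPhase m s (⌊x / c⌋₊ + 1))
      (Set.Ioi 0) := by
    refine Integrable.mono' hexpi (Measurable.aestronglyMeasurable ?_) (ae_of_all _ fun x => ?_)
    · refine Measurable.mul (by fun_prop)
        ((measurable_from_top (f := fun n => logPhase m s (n + 1))).comp ?_)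
      exact Nat.measurable_floor.comp (measurable_id.div_const c)
    · rw [norm_mul, norm_logPhase, Complex.norm_real, Real.norm_of_nonneg (Real.exp_pos _).le,
        mul_one]
  have hi2 : IntegrableOn (fun x : ℝ => (Real.exp (-x) : ℂ) *
      Complex.exp (Complex.I * (s * (Real.log x + Real.eulerMascheroniConstant) : ℝ)))
      (Set.Ioi 0) := by
    refine Integrable.mono' hexpi (Measurable.aestronglyMeasurable ?_) (ae_of_all _ fun x => ?_)
    · have := Real.measurable_log
      fun_prop
    · rw [norm_mul, mul_comm Complex.I, Complex.norm_exp_ofReal_mul_I, Complex.norm_real,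
        Real.norm_of_nonneg (Real.exp_pos _).le, mul_one]
  rw [geomMean_eq_integral hm (fun w => (norm_logPhase m s w).le) hc, logExpChar_eq_integral,
    ← integral_sub hi1 hi2]
  have hbi := ((hgami.const_mul (2 * √c)).add (hexpi.const_mul (2 / m))).const_mul |s|
  refine (norm_integral_le_of_norm_le hbi
    ((ae_restrict_iff' measurableSet_Ioi).2 (ae_of_all _ hpt))).trans ?_
  have hval : ∫ x in Set.Ioi (0 : ℝ), |s| * (2 * √c * (Real.exp (-x) * x ^ ((1 / 2 : ℝ) - 1))
      + 2 / m * Real.exp (-x)) = |s| * (2 * √c * √Real.pi + 2 / m) := by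
    rw [integral_const_mul, integral_add (hgami.const_mul (2 * √c)) (hexpi.const_mul (2 / m)),
      integral_const_mul, integral_const_mul, ← Real.Gamma_eq_integral (by norm_num),
      Real.Gamma_one_half_eq, integral_exp_neg_Ioi_zero, mul_one]
  refine (le_of_eq hval).trans ?_
  have hsm : 0 < √(m : ℝ) := Real.sqrt_pos.2 (by linarith)
  have hsm1 : 1 ≤ √(m : ℝ) := Real.one_le_sqrt.2 (by linarith)
  have hmm : √(m : ℝ) * √m = m := Real.mul_self_sqrt (by positivity)
  -- Here `c ≤ 2/m` and `π ≤ 4` give `cπ ≤ 8/m`, rounded up to `9/m` for an exact root.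
  have h7 : √c * √Real.pi ≤ 3 / √m := by
    rw [← Real.sqrt_mul hc0.le, show (3 : ℝ) / √m = √(9 / m) by
      rw [Real.sqrt_div (by norm_num), show (9 : ℝ) = 3 ^ 2 by norm_num,
        Real.sqrt_sq (by norm_num)]]
    refine Real.sqrt_le_sqrt ?_
    calc c * Real.pi ≤ 2 / m * 4 :=
          mul_le_mul (hc2.trans hm1) Real.pi_le_four Real.pi_pos.le (by positivity)
      _ ≤ 9 / m := by rw [div_mul_eq_mul_div]; gcongr; norm_num
  have h8 : 2 / (m : ℝ) ≤ 2 / √m := by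
    refine div_le_div_of_nonneg_left (by norm_num) hsm ?_
    nlinarith
  calc |s| * (2 * √c * √Real.pi + 2 / m) ≤ |s| * (2 * (3 / √m) + 2 / √m) := by
        refine mul_le_mul_of_nonneg_left ?_ (abs_nonneg s)
        linarith
    _ = 8 * |s| / √m := by ring

/-! ### Second-order expansion at zero and the Gaussian limit. -/

/-- `z ↦ exp (γ z) Γ (1 + z)`, the moment generating function of the centred logarithm of an
exponential random variable. -/
noncomputable def logExpMgf (z : ℂ) : ℂ :=
  Complex.exp (Real.eulerMascheroniConstant * z) * Complex.Gamma (1 + z)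

/-- Euler's reflection formula. It yields the second-order coefficient without the second derivative
of `Γ` at `1`. -/
theorem logExpMgf_mul_neg {z : ℂ} (hz : z ≠ 0) :
    logExpMgf z * logExpMgf (-z) = Real.pi * z / Complex.sin (Real.pi * z) := by
  have h := Complex.Gamma_mul_Gamma_one_sub z
  have e : Complex.exp (Real.eulerMascheroniConstant * z)
      * Complex.exp (Real.eulerMascheroniConstant * -z) = 1 := by
    rw [← Complex.exp_add]; simp
  rw [logExpMgf, logExpMgf, mul_mul_mul_comm, e, one_mul, add_comm 1 z, Complex.Gamma_add_one z hz,
    ← sub_eq_add_neg, mul_assoc, h]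
  ring

theorem differentiableAt_Gamma_one_add {z : ℂ} (hz : ‖z‖ < 1) :
    DifferentiableAt ℂ (fun z => Complex.Gamma (1 + z)) z := by
  have h : DifferentiableAt ℂ Complex.Gamma (1 + z) := by
    refine Complex.differentiableAt_Gamma _ fun n h => ?_
    have h1 : (1 + z).re = -(n : ℝ) := by rw [h]; simp
    have h2 := (abs_le.1 (Complex.abs_re_le_norm z)).1
    simp only [Complex.add_re, Complex.one_re] at h1
    have : (0 : ℝ) ≤ n := n.cast_nonneg
    linarith
  exact h.comp z (by fun_prop)

theorem analyticAt_logExpMgf : AnalyticAt ℂ logExpMgf 0 := by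
  refine DifferentiableOn.analyticAt (s := Metric.ball 0 1) (fun z hz => ?_)
    (Metric.ball_mem_nhds 0 one_pos)
  have := differentiableAt_Gamma_one_add (mem_ball_zero_iff.1 hz)
  exact (DifferentiableAt.mul (by fun_prop) this).differentiableWithinAt

/-- Since `Γ'(1) = -γ`, the factor `exp (γ z)` cancels the first-order term: `log E + γ` is centred.
-/
theorem hasDerivAt_logExpMgf_zero : HasDerivAt logExpMgf 0 0 := by
  have h1 : HasDerivAt (fun z : ℂ => Complex.Gamma (1 + z)) (-Real.eulerMascheroniConstant) 0 := by
    have := Complex.hasDerivAt_Gamma_one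
    rw [← add_zero (1 : ℂ)] at this
    simpa using HasDerivAt.comp_const_add (1 : ℂ) 0 this
  have h2 : HasDerivAt (fun z : ℂ => Complex.exp (Real.eulerMascheroniConstant * z))
      Real.eulerMascheroniConstant 0 := by
    have := ((hasDerivAt_id (0 : ℂ)).const_mul (Real.eulerMascheroniConstant : ℂ)).cexp
    simpa using this
  have h : HasDerivAt logExpMgf _ 0 := h2.mul h1
  simpa using h

theorem tendsto_div_sin_sub_one_div_sq :
    Tendsto (fun z : ℂ => (z / Complex.sin z - 1) / z ^ 2) (𝓝[≠] 0) (𝓝 (1 / 6)) := by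
  have hsin : Tendsto (fun z : ℂ => Complex.sin z / z) (𝓝[≠] 0) (𝓝 1) := by
    have := (Complex.hasDerivAt_sin 0).tendsto_slope_zero
    simpa [div_eq_inv_mul] using this
  have hcub : Tendsto (fun z : ℂ => (z - Complex.sin z) / z ^ 3) (𝓝[≠] 0) (𝓝 (1 / 6)) := by
    rw [tendsto_iff_norm_sub_tendsto_zero]
    have h0 : Tendsto (fun z : ℂ => ‖z‖ ^ 2 / 100) (𝓝[≠] 0) (𝓝 0) := by
      have : Continuous fun z : ℂ => ‖z‖ ^ 2 / 100 := by fun_prop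
      have := this.tendsto 0
      simp only [norm_zero, ne_eq, OfNat.ofNat_ne_zero, not_false_eq_true, zero_pow, zero_div] at this
      exact this.mono_left nhdsWithin_le_nhds
    refine squeeze_zero' (Eventually.of_forall fun _ => norm_nonneg _) ?_ h0
    have hb : ∀ᶠ z : ℂ in 𝓝[≠] 0, ‖z‖ ≤ 1 := by
      refine nhdsWithin_le_nhds ?_
      filter_upwards [Metric.closedBall_mem_nhds (0 : ℂ) one_pos] with z hz
      simpa using hz
    filter_upwards [hb, self_mem_nhdsWithin] with z hz hz0
    have hz0 : z ≠ 0 := hz0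
    have e : (z - Complex.sin z) / z ^ 3 - 1 / 6 = -(Complex.sin z - (z - z ^ 3 / 6)) / z ^ 3 := by
      field_simp
      ring
    rw [e, norm_div, norm_neg, norm_pow, div_le_iff₀ (by positivity)]
    refine (Complex.sin_bound hz).trans (le_of_eq (by ring))
  have := hcub.div hsin one_ne_zero
  rw [div_one] at this
  refine this.congr' ?_
  have hs0 : ∀ᶠ z : ℂ in 𝓝[≠] 0, Complex.sin z / z ≠ 0 := hsin.eventually_ne one_ne_zero
  filter_upwards [hs0, self_mem_nhdsWithin] with z hz hz0
  have hz0 : z ≠ 0 := hz0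
  have hs : Complex.sin z ≠ 0 := fun h => hz (by simp [h])
  simp only [Pi.div_apply]
  field_simp

/-- Write `logExpMgf z = 1 + z² g(z)` with `g` analytic. In `logExpMgf z * logExpMgf (-z)` the
coefficient of `z²` is `2 g(0)`, while `πz / sin (πz)` has coefficient `π²/6`; hence `g(0) = π²/12`.
-/
theorem tendsto_logExpMgf_sub_one_div_sq :
    Tendsto (fun z : ℂ => (logExpMgf z - 1) / z ^ 2) (𝓝[≠] 0) (𝓝 ((Real.pi : ℂ) ^ 2 / 12)) := by
  have hG0 : logExpMgf 0 = 1 := by simp [logExpMgf]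
  have hA : AnalyticAt ℂ (fun z => logExpMgf z - 1) 0 := analyticAt_logExpMgf.sub analyticAt_const
  have hord : ((2 : ℕ) : ℕ∞) ≤ analyticOrderAt (fun z => logExpMgf z - 1) 0 := by
    rw [natCast_le_analyticOrderAt_iff_iteratedDeriv_eq_zero hA]
    intro i hi
    interval_cases i
    · simp [hG0]
    · rw [iteratedDeriv_one]
      exact (hasDerivAt_logExpMgf_zero.sub_const 1).deriv
  obtain ⟨g, hg, hev⟩ := (natCast_le_analyticOrderAt hA).1 hord
  have hev : ∀ᶠ z in 𝓝 (0 : ℂ), logExpMgf z = 1 + z ^ 2 * g z := by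
    filter_upwards [hev] with z hz
    rw [sub_zero, smul_eq_mul] at hz
    linear_combination hz
  have hneg : Tendsto (fun z : ℂ => -z) (𝓝 0) (𝓝 0) := by
    simpa using (continuous_neg (G := ℂ)).tendsto 0
  have hgc := hg.continuousAt.tendsto
  have hlim1 : Tendsto (fun z : ℂ => g z + g (-z) + z ^ 2 * (g z * g (-z))) (𝓝[≠] 0)
      (𝓝 (g 0 + g 0)) := by
    have hgn := hgc.comp hneg
    have hz2 : Tendsto (fun z : ℂ => z ^ 2) (𝓝 0) (𝓝 0) := by
      have := (continuous_pow (M := ℂ) 2).tendsto 0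
      simpa using this
    have := (hgc.add hgn).add (hz2.mul (hgc.mul hgn))
    rw [zero_mul, add_zero] at this
    exact this.mono_left nhdsWithin_le_nhds
  have hpi : (Real.pi : ℂ) ≠ 0 := by exact_mod_cast Real.pi_ne_zero
  have hlim2 : Tendsto (fun z : ℂ => g z + g (-z) + z ^ 2 * (g z * g (-z))) (𝓝[≠] 0)
      (𝓝 (1 / 6 * Real.pi ^ 2)) := by
    have hmul : Tendsto (fun z : ℂ => Real.pi * z) (𝓝[≠] 0) (𝓝[≠] 0) := by
      refine tendsto_nhdsWithin_iff.2 ⟨?_, ?_⟩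
      · have : Continuous fun z : ℂ => Real.pi * z := by fun_prop
        have := this.tendsto 0
        rw [mul_zero] at this
        exact this.mono_left nhdsWithin_le_nhds
      · filter_upwards [self_mem_nhdsWithin] with z hz
        exact mul_ne_zero hpi hz
    refine ((tendsto_div_sin_sub_one_div_sq.comp hmul).mul_const ((Real.pi : ℂ) ^ 2)).congr' ?_
    filter_upwards [nhdsWithin_le_nhds hev, nhdsWithin_le_nhds (hneg.eventually hev),
      self_mem_nhdsWithin] with z h1 h2 hz
    have hz : z ≠ 0 := hz
    have h3 := logExpMgf_mul_neg hz
    rw [h1, h2] at h3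
    simp only [Function.comp_apply]
    rw [← h3]
    field_simp
    ring
  have hg0 : g 0 = Real.pi ^ 2 / 12 := by
    have := tendsto_nhds_unique hlim1 hlim2
    linear_combination this / 2
  rw [← hg0]
  refine (hgc.mono_left nhdsWithin_le_nhds).congr' ?_
  filter_upwards [nhdsWithin_le_nhds hev, self_mem_nhdsWithin] with z h1 hz
  have hz : z ≠ 0 := hz
  rw [h1]
  field_simp
  ring

theorem tendsto_logExpChar_pow (t : ℝ) :
    Tendsto (fun n : ℕ => logExpChar (t / √(n * (Real.pi ^ 2 / 6))) ^ n) atTop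
      (𝓝 (Complex.exp (-(t ^ 2 / 2 : ℝ)))) := by
  -- The limit along the punctured neighbourhood of `0` needs a nonzero argument.
  by_cases ht : t = 0
  · subst ht
    simp [logExpChar]
  have hpi := Real.pi_pos
  have hz : Tendsto (fun n : ℕ => Complex.I * ((t / √(n * (Real.pi ^ 2 / 6)) : ℝ) : ℂ)) atTop
      (𝓝[≠] 0) := by
    refine tendsto_nhdsWithin_iff.2 ⟨?_, ?_⟩
    · have h1 : Tendsto (fun n : ℕ => t / √((n : ℝ) * (Real.pi ^ 2 / 6))) atTop (𝓝 0) :=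
        tendsto_const_nhds.div_atTop (Real.tendsto_sqrt_atTop.comp
          (tendsto_natCast_atTop_atTop.atTop_mul_const (by positivity)))
      have h2 := (Complex.continuous_ofReal.tendsto 0).comp h1
      simpa using h2.const_mul Complex.I
    · filter_upwards [eventually_gt_atTop 0] with n hn
      have : t / √((n : ℝ) * (Real.pi ^ 2 / 6)) ≠ 0 := div_ne_zero ht (by positivity)
      exact mul_ne_zero Complex.I_ne_zero (by exact_mod_cast this)
  -- The factor is `n z²` for `z = it/√(nπ²/6)`, so the product tends to `-t²/2`.
  have hlim := (tendsto_logExpMgf_sub_one_div_sq.comp hz).mul_const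
    (-((t ^ 2 : ℝ) / ((Real.pi ^ 2 / 6 : ℝ) : ℂ)))
  have hpow : Tendsto (fun n : ℕ =>
      (1 + (logExpChar (t / √(n * (Real.pi ^ 2 / 6))) - 1)) ^ n) atTop
      (𝓝 (Complex.exp (-(t ^ 2 / 2 : ℝ)))) := by
    refine Complex.tendsto_one_add_pow_exp_of_tendsto ?_
    have hpi' : (Real.pi : ℂ) ≠ 0 := by exact_mod_cast hpi.ne'
    have e : (Real.pi ^ 2 / 12 : ℂ) * (-((t ^ 2 : ℝ) / ((Real.pi ^ 2 / 6 : ℝ) : ℂ)))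
        = -(t ^ 2 / 2 : ℝ) := by
      push_cast
      field_simp
      ring
    rw [e] at hlim
    refine hlim.congr' ?_
    filter_upwards [eventually_gt_atTop 0] with n hn
    have hn0 : (n : ℂ) ≠ 0 := by exact_mod_cast hn.ne'
    have ht0 : (t : ℂ) ≠ 0 := by exact_mod_cast ht
    have hsq : (Complex.I * ((t / √(n * (Real.pi ^ 2 / 6)) : ℝ) : ℂ)) ^ 2
        = -((t ^ 2 / (n * (Real.pi ^ 2 / 6)) : ℝ) : ℂ) := by
      rw [mul_pow, Complex.I_sq, ← Complex.ofReal_pow, div_pow, Real.sq_sqrt (by positivity)]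
      ring
    simp only [Function.comp_apply]
    rw [hsq, show logExpChar (t / √(n * (Real.pi ^ 2 / 6)))
      = logExpMgf (Complex.I * ((t / √(n * (Real.pi ^ 2 / 6)) : ℝ) : ℂ)) from rfl]
    push_cast
    field_simp
  simpa using hpow

/-! ### Blocks, entropy and the assembled estimate. -/

theorem isUniformSequence_block {Ω : Type*} [MeasurableSpace Ω] {P : Measure Ω}
    [IsProbabilityMeasure P] {A : Type*} [Fintype A] [MeasurableSpace A]
    [MeasurableSingletonClass A] {Z : ℕ → Ω → A} (hZ_meas : ∀ n, Measurable (Z n))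
    (hZ_indep : iIndepFun Z P)
    (hZ_equi : ∀ n a, P.real (Z n ⁻¹' {a}) = 1 / (Fintype.card A : ℝ)) (ℓ : ℕ) :
    IsUniformSequence (block Z ℓ) P where
  measurable j := measurable_pi_lambda _ fun _ => hZ_meas _
  uniform j a := by
    have hinj : Function.Injective fun r : Fin ℓ => j * ℓ + (r : ℕ) := fun r r' h =>
      Fin.ext (by simpa using h)
    have hset : block Z ℓ j ⁻¹' {a} = ⋂ r : Fin ℓ, Z (j * ℓ + (r : ℕ)) ⁻¹' {a r} := by
      ext ω
      simp [block, funext_iff]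
    have hprod := (hZ_indep.precomp hinj).meas_iInter
      (s := fun r : Fin ℓ => Z (j * ℓ + (r : ℕ)) ⁻¹' {a r})
      fun r => ⟨{a r}, measurableSet_singleton _, rfl⟩
    rw [hset, measureReal_def, hprod, ENNReal.toReal_prod]
    simp only [← measureReal_def, hZ_equi]
    simp
  indep j := by
    -- Block `j` uses times before `(j + 1) * ℓ`, later blocks only times from there on.
    have h := indep_iSup_of_disjoint (fun i => (hZ_meas i).comap_le) hZ_indep.iIndep
      (S := Set.Iio ((j + 1) * ℓ)) (T := Set.Ici ((j + 1) * ℓ))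
      (Set.disjoint_left.2 fun n (h1 : n < _) (h2 : _ ≤ n) => absurd h1 (not_lt.2 h2))
    refine indep_of_indep_of_le_left (indep_of_indep_of_le_right h ?_) ?_
    · refine iSup₂_le fun i hi => ?_
      have hi : j + 1 ≤ i := hi
      rw [← measurable_iff_comap_le]
      refine @measurable_pi_lambda _ _ _ (_) _ _ fun r => ?_
      refine Measurable.mono (comap_measurable (Z (i * ℓ + r))) ?_ le_rfl
      refine le_iSup₂_of_le (i * ℓ + (r : ℕ)) ?_ le_rfl
      exact (Nat.mul_le_mul_right ℓ hi).trans (Nat.le_add_right _ _)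
    · rw [← measurable_iff_comap_le]
      refine @measurable_pi_lambda _ _ _ (_) _ _ fun r => ?_
      refine Measurable.mono (comap_measurable (Z (j * ℓ + r))) ?_ le_rfl
      refine le_iSup₂_of_le (j * ℓ + (r : ℕ)) ?_ le_rfl
      have := r.isLt
      simp only [Set.mem_Iio, add_mul, one_mul]
      omega

theorem entropyBits_mul_log_two {Ω : Type*} [MeasurableSpace Ω] {P : Measure Ω} {A : Type*}
    [Fintype A] [Nonempty A] {X : Ω → A}
    (hX : ∀ a, P.real (X ⁻¹' {a}) = 1 / (Fintype.card A : ℝ)) :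
    entropyBits P X * Real.log 2 = Real.log (Fintype.card A) := by
  have hm : (Fintype.card A : ℝ) ≠ 0 := by positivity
  have h2 : Real.log 2 ≠ 0 := (Real.log_pos one_lt_two).ne'
  simp only [entropyBits, hX, Real.logb, one_div, Real.log_inv, Finset.sum_const, Finset.card_univ,
    nsmul_eq_mul]
  field_simp

/-- The characteristic function of a normalized sum of centred logarithms of return times. -/
theorem IsUniformSequence.norm_charFun_sum_log_return_sub_le {Ω B : Type*} [MeasurableSpace Ω]
    {P : Measure Ω} [IsProbabilityMeasure P] [Fintype B] [MeasurableSpace B]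
    [MeasurableSingletonClass B] {X : ℕ → Ω → B} (hX : IsUniformSequence X P)
    (hB : 2 ≤ Fintype.card B) (s : ℝ) (n : ℕ) :
    ‖∫ ω, Complex.exp (Complex.I * (s * ∑ j ∈ Finset.range n,
        (Real.log (hit X j (X j ω) ω) - Real.log (Fintype.card B)
          + Real.eulerMascheroniConstant) : ℝ)) ∂P - logExpChar s ^ n‖
      ≤ n * (12 * |s| / √(Fintype.card B)) := by
  have hδ : ∀ j, ∫ ω, ‖hitMean X (logPhase (Fintype.card B) s) j ω - logExpChar s‖ ∂P
      ≤ 12 * |s| / √(Fintype.card B) := by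
    intro j
    set f := logPhase (Fintype.card B) s
    have h1 := hX.integral_norm_hitMean_sub_le hB
      (fun u => norm_logPhase_sub_le (Fintype.card B) s u) j
    have h2 := norm_geomMean_logPhase_sub_le hB s
    have hMi : Integrable (hitMean X f j) P :=
      Integrable.of_bound ((measurable_hitMean_future f j).mono (hX.future_le j)
        le_rfl).aestronglyMeasurable 1
        (ae_of_all _ (norm_hitMean_le (fun w => (norm_logPhase _ s w).le) j))
    have hDi : ∀ z : ℂ, Integrable (fun ω => ‖hitMean X f j ω - z‖) P := fun z =>
      (hMi.sub (integrable_const z)).norm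
    calc ∫ ω, ‖hitMean X f j ω - logExpChar s‖ ∂P
        ≤ ∫ ω, (‖hitMean X f j ω - geomMean (Fintype.card B) f‖
            + ‖geomMean (Fintype.card B) f - logExpChar s‖) ∂P :=
          integral_mono (hDi _) ((hDi _).add (integrable_const _))
            fun ω => norm_sub_le_norm_sub_add_norm_sub _ _ _
      _ ≤ 4 * |s| / √(Fintype.card B) + 8 * |s| / √(Fintype.card B) := by
          rw [integral_add (hDi _) (integrable_const _)]
          simpa using add_le_add h1 h2
      _ = 12 * |s| / √(Fintype.card B) := by ring
  have h := hX.norm_integral_prod_return_sub_pow_le (fun w => (norm_logPhase _ s w).le)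
    (norm_logExpChar_le s) hδ n 0
  convert h using 5 with ω
  simp only [logPhase, zero_add, ← Complex.exp_sum]
  congr 1
  rw [← Finset.mul_sum, Finset.mul_sum]
  push_cast
  rfl

end ReturnTimeCLT

theorem proposition3p5
    {Ω : Type*} [MeasurableSpace Ω] (P : Measure Ω) [IsProbabilityMeasure P]
    {A : Type*} [Fintype A] [MeasurableSpace A] [MeasurableSingletonClass A]
    (Z : ℕ → Ω → A)
    (hZ_meas : ∀ n, Measurable (Z n))
    (hZ_indep : iIndepFun Z P)
    (hZ_equi : ∀ n a, P.real (Z n ⁻¹' {a}) = 1 / (Fintype.card A : ℝ))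
    (H : ℝ) (hH : H = ReturnTimeCLT.entropyBits P (Z 0))
    (k : ℕ → ℕ) (hk : Tendsto k atTop atTop)
    (hk_growth : Tendsto (fun ℓ : ℕ => (k ℓ : ℝ) * (ℓ : ℝ) * ((Fintype.card A : ℝ) ^ ℓ)⁻¹)
      atTop (𝓝 0)) :
    TendstoInDistribution
      (fun (ℓ : ℕ) (ω : Ω) =>
        (∑ j ∈ Finset.range (k ℓ),
          (Real.log (ReturnTimeCLT.returnTime Z ℓ j ω : ℝ) - (ℓ : ℝ) * H * Real.log 2
            + Real.eulerMascheroniConstant))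
          / Real.sqrt ((k ℓ : ℝ) * (Real.pi ^ 2 / 6)))
      atTop (id : ℝ → ℝ) (fun _ => P) (gaussianReal 0 1) := by
  obtain ⟨ω₀⟩ : Nonempty Ω := P.nonempty_of_neZero
  have : Nonempty A := ⟨Z 0 ω₀⟩
  have hX := ReturnTimeCLT.isUniformSequence_block hZ_meas hZ_indep hZ_equi
  have hlogH : ∀ ℓ : ℕ, (ℓ : ℝ) * H * Real.log 2 = Real.log (Fintype.card (Fin ℓ → A)) := by
    intro ℓ
    rw [mul_assoc, hH, ReturnTimeCLT.entropyBits_mul_log_two (hZ_equi 0)]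
    simp
  have hmeas : ∀ ℓ, Measurable fun ω : Ω => (∑ j ∈ Finset.range (k ℓ),
      (Real.log (ReturnTimeCLT.returnTime Z ℓ j ω : ℝ) - (ℓ : ℝ) * H * Real.log 2
        + Real.eulerMascheroniConstant)) / Real.sqrt ((k ℓ : ℝ) * (Real.pi ^ 2 / 6)) := by
    intro ℓ
    refine (Finset.measurable_fun_sum _ fun j _ => ?_).div_const _
    refine ((Measurable.comp (measurable_from_top (f := fun n : ℕ => Real.log n))
      (?_ : Measurable (ReturnTimeCLT.returnTime Z ℓ j))).sub_const _).add_const _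
    refine ReturnTimeCLT.measurable_sInf_nat fun t => ?_
    by_cases ht : 1 ≤ t
    · simp only [ht, true_and]
      exact measurableSet_eq_fun ((hX ℓ).measurable _) ((hX ℓ).measurable _)
    · simp [ht]
  -- For a one-letter alphabet the growth hypothesis would say `k ℓ * ℓ → 0`, which is impossible.
  have hcard : 2 ≤ Fintype.card A := by
    by_contra hlt
    have h1 : Fintype.card A = 1 := by have := Fintype.card_pos (α := A); omega
    have hinf : Tendsto (fun ℓ : ℕ => (k ℓ : ℝ) * (ℓ : ℝ) * ((Fintype.card A : ℝ) ^ ℓ)⁻¹)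
        atTop atTop := by
      simpa [h1] using (tendsto_natCast_atTop_atTop.comp hk).atTop_mul_atTop₀
        (tendsto_natCast_atTop_atTop (R := ℝ))
    exact not_tendsto_nhds_of_tendsto_atTop hinf 0 hk_growth
  have hratio : Tendsto (fun ℓ : ℕ => (k ℓ : ℝ) / (Fintype.card A : ℝ) ^ ℓ) atTop (𝓝 0) := by
    refine squeeze_zero' (Eventually.of_forall fun ℓ => by positivity) ?_ hk_growth
    filter_upwards [eventually_ge_atTop 1] with ℓ hℓ
    rw [div_eq_mul_inv]
    refine mul_le_mul_of_nonneg_right ?_ (by positivity)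
    exact le_mul_of_one_le_right (by positivity) (by exact_mod_cast hℓ)
  refine ⟨fun ℓ => (hmeas ℓ).aemeasurable, aemeasurable_id, ?_⟩
  refine ProbabilityMeasure.tendsto_iff_tendsto_charFun.2 fun t => ?_
  simp only [ProbabilityMeasure.coe_mk, Measure.map_id, charFun_gaussianReal]
  have hmain := (ReturnTimeCLT.tendsto_logExpChar_pow t).comp hk
  have hgauss : Complex.exp (t * (0 : ℝ) * Complex.I - ((1 : NNReal) : ℝ) * t ^ 2 / 2)
      = Complex.exp (-(t ^ 2 / 2 : ℝ)) := by
    congr 1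
    push_cast
    ring
  rw [hgauss]
  refine (tendsto_iff_of_dist ?_).2 hmain
  -- This is `k * 12|s|/√m` at `s = t/√(kπ²/6)` and `m = |A|^ℓ`.
  have hbound : Tendsto (fun ℓ : ℕ => 12 * |t| / √(Real.pi ^ 2 / 6)
      * √((k ℓ : ℝ) / (Fintype.card A : ℝ) ^ ℓ)) atTop (𝓝 0) := by
    have := (Real.continuous_sqrt.tendsto 0).comp hratio
    rw [Real.sqrt_zero] at this
    have := this.const_mul (12 * |t| / √(Real.pi ^ 2 / 6))
    rwa [mul_zero] at this
  refine squeeze_zero' (Eventually.of_forall fun ℓ => dist_nonneg) ?_ hbound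
  filter_upwards [eventually_ge_atTop 1, hk.eventually_gt_atTop 0] with ℓ hℓ hkℓ
  have hB : 2 ≤ Fintype.card (Fin ℓ → A) := by
    rw [Fintype.card_fun, Fintype.card_fin]
    exact hcard.trans (Nat.le_self_pow (by omega) _)
  have h := (hX ℓ).norm_charFun_sum_log_return_sub_le hB
    (t / √((k ℓ : ℝ) * (Real.pi ^ 2 / 6))) (k ℓ)
  rw [dist_eq_norm]
  have hcf : charFun (Measure.map (fun ω : Ω => (∑ j ∈ Finset.range (k ℓ),
      (Real.log (ReturnTimeCLT.returnTime Z ℓ j ω : ℝ) - (ℓ : ℝ) * H * Real.log 2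
        + Real.eulerMascheroniConstant)) / Real.sqrt ((k ℓ : ℝ) * (Real.pi ^ 2 / 6))) P) t
      = ∫ ω, Complex.exp (Complex.I * ((t / √((k ℓ : ℝ) * (Real.pi ^ 2 / 6)))
        * ∑ j ∈ Finset.range (k ℓ),
        (Real.log (ReturnTimeCLT.hit (ReturnTimeCLT.block Z ℓ) j (ReturnTimeCLT.block Z ℓ j ω) ω)
          - Real.log (Fintype.card (Fin ℓ → A)) + Real.eulerMascheroniConstant) : ℝ)) ∂P := by
    rw [charFun_apply_real, integral_map (hmeas ℓ).aemeasurable (by fun_prop)]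
    refine integral_congr_ae (ae_of_all _ fun ω => ?_)
    simp only [hlogH, ReturnTimeCLT.returnTime, ReturnTimeCLT.hit]
    congr 1
    push_cast
    ring
  simp only [Function.comp_apply]
  rw [hcf]
  refine h.trans (le_of_eq ?_)
  have hcardB : ((Fintype.card (Fin ℓ → A) : ℕ) : ℝ) = (Fintype.card A : ℝ) ^ ℓ := by
    simp
  have hk0 : (0 : ℝ) < k ℓ := by exact_mod_cast hkℓ
  have hpi : 0 < √(Real.pi ^ 2 / 6) := Real.sqrt_pos.2 (by have := Real.pi_pos; positivity)
  have hA0 : 0 < √((Fintype.card A : ℝ) ^ ℓ) := Real.sqrt_pos.2 (by positivity)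
  have hsk : 0 < √(k ℓ : ℝ) := Real.sqrt_pos.2 hk0
  rw [hcardB, abs_div, abs_of_nonneg (Real.sqrt_nonneg _), Real.sqrt_mul hk0.le,
    Real.sqrt_div hk0.le]
  nth_rewrite 1 [← Real.mul_self_sqrt hk0.le]
  field_simp
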